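/- Let $N$ be a positive integer with $N\equiv 5 \pmod 8$ (for instance a square-free one), let $\mathcal A=\mathbb Z[\sqrt N]$ with norm $\mathrm{Nm}(x+y\sqrt N)=x^2-Ny^2$, and for either sign let $I_\pm=[4,\sqrt N\pm 1]$ be the ideal of $\mathcal A$ generated by $4$ and $\sqrt N\pm1$ (these two elements are also a $\mathbb Z$-basis of it). Call two real numbers with infinite, eventually periodic continued fractions equivalent if their continued fractions have the same periodic part (as a cycle), i.e. if both end in one and the same purely periodic sequence of partial quotients. Then the following are equivalent: (a) At least one of the equations $x^2-Ny^2=4$, $x^2-Ny^2=-4$ has a solution in odd integers $x,y$. (b) There is an element of $\mathcal A$ of norm $4$ or $-4$ that is not a unit of $\mathcal A$ times a rational integer. (c) The ideals $I_\pm$ are principal. (d) The numbers $\frac{\sqrt N\pm 1}{4}$ are equivalent to $\sqrt N$ (in particular their continued fractions are eventually periodic). Here (c) and (d) may be read for both signs or for any single sign: the six statements (a), (b), $I_+$ principal, $I_-$ principal, $\frac{\sqrt N+1}{4}$ equivalent to $\sqrt N$, $\frac{\sqrt N-1}{4}$ equivalent to $\sqrt N$ are all equivalent. -/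

import Mathlib

/-- The continued fraction of `x` is infinite and, from some place on, its partial quotients are
`a 0, a 1, a 2, …`. -/
def CFEndsIn (x : ℝ) (a : ℕ → ℤ) : Prop :=
  ∃ m : ℕ, ∀ k : ℕ, (GenContFract.of x).partDens.get? (m + k) = some (a k : ℝ)

/-- Equivalence of two (eventually periodic) continued fractions: both are eventually periodic and
their periodic parts are the same cycle, that is, both end in one and the same
purely periodic sequence of partial quotients. -/
def CFEquivalent (x y : ℝ) : Prop :=
  ∃ (l : ℕ) (a : ℕ → ℤ), 0 < l ∧ Function.Periodic a l ∧ CFEndsIn x a ∧ CFEndsIn y a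

/-- The ideal `[4, √N + s]` of `ℤ[√N]`; it is used for `s = 1` and `s = -1`. -/
def idealI (N s : ℤ) : Ideal (Zsqrtd N) :=
  Ideal.span {(4 : Zsqrtd N), Zsqrtd.sqrtd + (s : Zsqrtd N)}

/-- For `N ≡ 1 mod 4` and `s = ± 1` the two generators of the ideal also generate it as
a lattice. -/
theorem mem_idealI_iff_lattice (N s : ℤ) (hN : N ≡ 1 [ZMOD 4]) (hs : s = 1 ∨ s = -1)
    (z : Zsqrtd N) :
    z ∈ idealI N s ↔
      ∃ u v : ℤ, z = (u : Zsqrtd N) * 4 + (v : Zsqrtd N) * (Zsqrtd.sqrtd + (s : Zsqrtd N)) := by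
  obtain ⟨t, ht⟩ := hN.symm.dvd
  have hN' : N = 1 + 4 * t := by linarith
  have hss : s * s = 1 := by rcases hs with rfl | rfl <;> norm_num
  unfold idealI
  rw [Ideal.mem_span_pair]
  constructor
  · rintro ⟨⟨p, q⟩, ⟨r, w⟩, rfl⟩
    refine ⟨p - s * q + w * t, 4 * q + r + w * s, ?_⟩
    ext
    · simp [Zsqrtd.re_ofNat, Zsqrtd.im_ofNat]
      linear_combination w * hN' - w * hss
    · simp [Zsqrtd.re_ofNat, Zsqrtd.im_ofNat]
      ring
  · rintro ⟨u, v, rfl⟩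
    exact ⟨u, v, rfl⟩

/-! Everything is reduced to `OddPellFour`. Since `N` is odd, `x` and `y` in `x² - Ny² = ±4` have
equal parity, and the even solutions are exactly `2` times units. A generator of `idealI` must have
norm `±4` and cannot be divisible by `2`; conversely an odd solution, its sign chosen so that `4 ∣ x
- s * y`, generates the ideal. For continued fractions, Serret's theorem turns equivalence into an
integral Möbius map of determinant `±1`. Comparing coefficients of `1` and `√N` in such a map from
`(√N + s)/4` to `√N` gives `a² - Nc² = 4(ad - bc) = ±4`. Periodicity comes from the finiteness of
reduced numbers (Lagrange). -/

/-- The complete quotient following `x` in its continued fraction expansion. -/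
noncomputable def cfShift (x : ℝ) : ℝ := (Int.fract x)⁻¹

/-- `x` and `y` have a complete quotient in common. -/
def CompleteQuotientEquiv (x y : ℝ) : Prop :=
  ∃ m n : ℕ, cfShift^[m] x = cfShift^[n] y

/-- `y` is the image of `x` under an integral Möbius transformation of determinant `1` or `-1`. -/
def IntMoebiusEquiv (x y : ℝ) : Prop :=
  ∃ a b c d : ℤ, (a * d - b * c = 1 ∨ a * d - b * c = -1) ∧ y * (c * x + d) = a * x + b

/-! ### Serret's theorem: common complete quotients versus integral Möbius maps -/

namespace CompleteQuotientEquiv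

theorem refl (x : ℝ) : CompleteQuotientEquiv x x := ⟨0, 0, rfl⟩

theorem symm {x y : ℝ} (h : CompleteQuotientEquiv x y) : CompleteQuotientEquiv y x := by
  obtain ⟨m, n, h⟩ := h
  exact ⟨n, m, h.symm⟩

theorem trans {x y z : ℝ} (hxy : CompleteQuotientEquiv x y) (hyz : CompleteQuotientEquiv y z) :
    CompleteQuotientEquiv x z := by
  obtain ⟨m, n, h⟩ := hxy
  obtain ⟨p, q, h'⟩ := hyz
  refine ⟨p + m, n + q, ?_⟩
  rw [Function.iterate_add_apply, h, ← Function.iterate_add_apply, add_comm p n,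
    Function.iterate_add_apply, h', ← Function.iterate_add_apply]

theorem cfShift_right (x : ℝ) : CompleteQuotientEquiv x (cfShift x) := ⟨1, 0, rfl⟩

theorem of_fract_eq {x y : ℝ} (h : Int.fract x = Int.fract y) : CompleteQuotientEquiv x y :=
  ⟨1, 1, by simp [cfShift, h]⟩

theorem add_int (x : ℝ) (n : ℤ) : CompleteQuotientEquiv x (x + n) :=
  of_fract_eq (Int.fract_add_intCast x n).symm

/-- Unless `x = 1`, one of `x`, `x⁻¹` lies in `(0, 1)`; it is its own fractional part, so its shift
is plain inversion. -/
theorem inv_of_pos {x : ℝ} (hx : 0 < x) : CompleteQuotientEquiv x x⁻¹ := by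
  have key : ∀ y : ℝ, 0 < y → y < 1 → CompleteQuotientEquiv y y⁻¹ := by
    intro y h0 h1
    have h := cfShift_right y
    rwa [cfShift, Int.fract_eq_self.2 ⟨h0.le, h1⟩] at h
  rcases lt_trichotomy x 1 with h | rfl | h
  · exact key x hx h
  · simpa using refl 1
  · simpa using (key x⁻¹ (inv_pos.2 hx) (inv_lt_one_of_one_lt₀ h)).symm

/-- For `0 < y < 1` inversions and integer translations lead through `1 - y`, `1/(1 - y)`, `y/(1 -
y)`, `1/y - 1`, `1/y`, `y`. With `y` the fractional part of `x`, `-x` differs from `1 - y` by an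
integer. -/
theorem neg {x : ℝ} (hx : Irrational x) : CompleteQuotientEquiv x (-x) := by
  have key : ∀ y : ℝ, Irrational y → 0 < y → y < 1 → y < 1 / 2 →
      CompleteQuotientEquiv y (1 - y) := by
    intro y hy h0 h1 h2
    have e1 : CompleteQuotientEquiv (1 - y) (1 - y)⁻¹ := inv_of_pos (by linarith)
    have e2 : CompleteQuotientEquiv ((1 - y)⁻¹) ((1 - y)⁻¹ + (-1 : ℤ)) := add_int _ _
    have e3 : (1 - y)⁻¹ + ((-1 : ℤ) : ℝ) = y / (1 - y) := by
      have : 1 - y ≠ 0 := by linarith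
      push_cast
      field_simp
      ring
    have e4 : CompleteQuotientEquiv (y / (1 - y)) (y / (1 - y))⁻¹ :=
      inv_of_pos (div_pos h0 (by linarith))
    have e5 : (y / (1 - y))⁻¹ = y⁻¹ + ((-1 : ℤ) : ℝ) := by
      push_cast
      field_simp
      ring
    rw [e3] at e2
    rw [e5] at e4
    exact ((e1.trans (e2.trans e4)).trans
      ((inv_of_pos h0).trans (add_int y⁻¹ (-1))).symm).symm
  have hf : Irrational (Int.fract x) := by
    rw [← Int.self_sub_floor]
    exact hx.sub_intCast _
  have h0 : 0 < Int.fract x := lt_of_le_of_ne (Int.fract_nonneg x) hf.ne_zero.symm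
  have h1 := Int.fract_lt_one x
  have main : CompleteQuotientEquiv (Int.fract x) (1 - Int.fract x) := by
    rcases lt_or_gt_of_ne (fun h : Int.fract x = 1 / 2 => hf ⟨1 / 2, by rw [h]; norm_num⟩)
      with h | h
    · exact key _ hf h0 h1 h
    · have hf' : Irrational (1 - Int.fract x) := by simpa using hf.intCast_sub 1
      have := key _ hf' (by linarith) (by linarith) (by linarith)
      rw [sub_sub_cancel] at this
      exact this.symm
  refine (of_fract_eq (Int.fract_fract x).symm).trans (main.trans (of_fract_eq ?_))
  rw [Int.fract_eq_fract]
  exact ⟨⌊x⌋ + 1, by push_cast; linarith [Int.self_sub_floor x]⟩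

end CompleteQuotientEquiv

namespace IntMoebiusEquiv

theorem refl (x : ℝ) : IntMoebiusEquiv x x := ⟨1, 0, 0, 1, by norm_num, by norm_num⟩

theorem symm {x y : ℝ} (h : IntMoebiusEquiv x y) : IntMoebiusEquiv y x := by
  obtain ⟨a, b, c, d, hdet, h⟩ := h
  refine ⟨-d, b, c, -a, ?_, ?_⟩
  · rcases hdet with h | h
    · left; linarith
    · right; linarith
  · push_cast; linarith

theorem trans {x y z : ℝ} (hxy : IntMoebiusEquiv x y) (hyz : IntMoebiusEquiv y z) :
    IntMoebiusEquiv x z := by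
  obtain ⟨a, b, c, d, hdet, h⟩ := hxy
  obtain ⟨a', b', c', d', hdet', h'⟩ := hyz
  refine ⟨a' * a + b' * c, a' * b + b' * d, c' * a + d' * c, c' * b + d' * d, ?_, ?_⟩
  · have : (a' * a + b' * c) * (c' * b + d' * d) - (a' * b + b' * d) * (c' * a + d' * c) =
        (a' * d' - b' * c') * (a * d - b * c) := by ring
    rw [this]
    rcases hdet with e | e <;> rcases hdet' with e' | e' <;> simp [e, e']
  · push_cast
    linear_combination (c * x + d) * h' + (a' - z * c') * h

theorem irrational {x y : ℝ} (h : IntMoebiusEquiv x y) (hx : Irrational x) : Irrational y := by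
  rintro ⟨q, rfl⟩
  obtain ⟨a, b, c, d, hdet, h⟩ := h
  by_cases hz : q * c - a = 0
  · have hz' : (q : ℝ) * c - a = 0 := by exact_mod_cast hz
    have h2 : (q : ℝ) * d = b := by linear_combination h - x * hz'
    have h3 : (a : ℝ) * d - b * c = 0 := by linear_combination -(d : ℝ) * hz' + c * h2
    have h4 : a * d - b * c = 0 := by exact_mod_cast h3
    omega
  · apply hx
    refine ⟨(b - q * d) / (q * c - a), ?_⟩
    have hz' : (q : ℝ) * c - a ≠ 0 := by exact_mod_cast hz
    push_cast
    rw [div_eq_iff hz']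
    linear_combination -h

theorem cfShift_right {x : ℝ} (hx : Irrational x) : IntMoebiusEquiv x (cfShift x) := by
  refine ⟨0, 1, 1, -⌊x⌋, by simp, ?_⟩
  have : Int.fract x ≠ 0 := by
    rw [← Int.self_sub_floor]
    exact (hx.sub_intCast _).ne_zero
  have e : ((1 : ℤ) : ℝ) * x + ((-⌊x⌋ : ℤ) : ℝ) = Int.fract x := by
    rw [← Int.self_sub_floor]; push_cast; ring
  rw [e, cfShift, inv_mul_cancel₀ this]
  simp

theorem iterate_cfShift {x : ℝ} (hx : Irrational x) (n : ℕ) :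
    IntMoebiusEquiv x (cfShift^[n] x) := by
  induction n with
  | zero => exact refl x
  | succ n ih =>
    rw [Function.iterate_succ_apply']
    exact ih.trans (cfShift_right (ih.irrational hx))

end IntMoebiusEquiv

theorem CompleteQuotientEquiv.intMoebiusEquiv {x y : ℝ} (h : CompleteQuotientEquiv x y)
    (hx : Irrational x) (hy : Irrational y) : IntMoebiusEquiv x y := by
  obtain ⟨m, n, h⟩ := h
  exact (IntMoebiusEquiv.iterate_cfShift hx m).trans
    (h ▸ (IntMoebiusEquiv.iterate_cfShift hy n).symm)

theorem irrational_iterate_cfShift {x : ℝ} (hx : Irrational x) (n : ℕ) :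
    Irrational (cfShift^[n] x) :=
  (IntMoebiusEquiv.iterate_cfShift hx n).irrational hx

open Matrix.SpecialLinearGroup in
-- `SL₂(ℤ)` is generated by `x ↦ -1/x` and `x ↦ x + 1`, both covered by the moves above. Quantifying
-- over `x` and `y` lets a product pass through an intermediate point.
theorem completeQuotientEquiv_of_mem_SL2Z (g : Matrix.SpecialLinearGroup (Fin 2) ℤ) :
    ∀ x y : ℝ, Irrational x → y * (g 1 0 * x + g 1 1) = g 0 0 * x + g 0 1 →
      CompleteQuotientEquiv x y := by
  have hg : g ∈ Subgroup.closure {ModularGroup.S, ModularGroup.T} := by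
    rw [SpecialLinearGroup.SL2Z_generators]
    trivial
  induction hg using Subgroup.closure_induction with
  | mem g hg =>
    intro x y hx h
    rcases hg with rfl | rfl
    · simp [ModularGroup.S] at h
      have hy : y = -x⁻¹ := by
        have := hx.ne_zero
        field_simp
        linarith
      subst hy
      rcases lt_or_gt_of_ne hx.ne_zero with h0 | h0
      · rw [← inv_neg]
        exact (CompleteQuotientEquiv.neg hx).trans
          (CompleteQuotientEquiv.inv_of_pos (by linarith))
      · exact (CompleteQuotientEquiv.inv_of_pos h0).trans (CompleteQuotientEquiv.neg hx.inv)
    · simp [ModularGroup.T] at h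
      rw [h]
      simpa using CompleteQuotientEquiv.add_int x 1
  | one =>
    intro x y hx h
    simp at h
    rw [h]
    exact CompleteQuotientEquiv.refl x
  | mul g₁ g₂ _ _ h₁ h₂ =>
    intro x y hx h
    have hdet := g₂.det_coe
    rw [Matrix.det_fin_two] at hdet
    have hden : (g₂ 1 0 : ℝ) * x + g₂ 1 1 ≠ 0 := by
      intro hz
      by_cases hc : g₂ 1 0 = 0
      · rw [hc] at hz hdet
        have : g₂ 1 1 = 0 := by simpa using hz
        simp [this] at hdet
      · exact ((hx.intCast_mul hc).add_intCast _).ne_zero hz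
    set z : ℝ := (g₂ 0 0 * x + g₂ 0 1) / (g₂ 1 0 * x + g₂ 1 1) with hz
    have hz' : z * (g₂ 1 0 * x + g₂ 1 1) = g₂ 0 0 * x + g₂ 0 1 := div_mul_cancel₀ _ hden
    refine (h₂ x z hx hz').trans (h₁ z y ?_ ?_)
    · exact IntMoebiusEquiv.irrational ⟨_, _, _, _, Or.inl hdet, hz'⟩ hx
    · simp [Matrix.mul_apply, Fin.sum_univ_two] at h
      apply mul_right_cancel₀ hden
      linear_combination h + (y * g₁ 1 0 - g₁ 0 0) * hz'
  | inv g _ ih =>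
    intro x y hx h
    have hdet := g.det_coe
    rw [Matrix.det_fin_two] at hdet
    simp [coe_inv, Matrix.adjugate_fin_two] at h
    refine (ih y x ?_ ?_).symm
    · refine IntMoebiusEquiv.irrational ⟨g 1 1, -g 0 1, -g 1 0, g 0 0, Or.inl ?_, ?_⟩ hx
      · linarith
      · push_cast; linarith
    · linarith

theorem IntMoebiusEquiv.completeQuotientEquiv {x y : ℝ} (h : IntMoebiusEquiv x y)
    (hx : Irrational x) : CompleteQuotientEquiv x y := by
  have hy := h.irrational hx
  obtain ⟨a, b, c, d, hdet | hdet, h⟩ := h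
  · exact completeQuotientEquiv_of_mem_SL2Z ⟨!![a, b; c, d], by simp [Matrix.det_fin_two, hdet]⟩
      x y hx (by simpa using h)
  -- Determinant `-1`: negating the top row gives determinant `1` and replaces `y` by `-y`.
  · refine (completeQuotientEquiv_of_mem_SL2Z
      ⟨!![-a, -b; c, d], by simp [Matrix.det_fin_two]; linarith⟩ x (-y) hx ?_).trans
      (CompleteQuotientEquiv.neg hy).symm
    simp
    linarith

/-! ### Partial quotients versus complete quotients -/

theorem partDens_get?_of_irrational {x : ℝ} (hx : Irrational x) (n : ℕ) :
    (GenContFract.of x).partDens.get? n = some (⌊cfShift^[n + 1] x⌋ : ℝ) := by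
  have hs : ∀ (n : ℕ) (x : ℝ), Irrational x →
      (GenContFract.of x).s.get? n = some ⟨1, (⌊cfShift^[n + 1] x⌋ : ℝ)⟩ := by
    intro n
    induction n with
    | zero =>
      intro x hx
      apply GenContFract.of_s_head
      rw [← Int.self_sub_floor]
      exact (hx.sub_intCast _).ne_zero
    | succ n ih =>
      intro x hx
      rw [GenContFract.of_s_succ, Function.iterate_succ_apply]
      exact ih _ (irrational_iterate_cfShift hx 1)
  exact GenContFract.partDen_eq_s_b (hs n x hx)

theorem cfEndsIn_iff {x : ℝ} (hx : Irrational x) {a : ℕ → ℤ} :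
    CFEndsIn x a ↔ ∃ m : ℕ, ∀ k : ℕ, ⌊cfShift^[m + k + 1] x⌋ = a k := by
  simp [CFEndsIn, partDens_get?_of_irrational hx]

theorem eq_of_floor_iterate_cfShift_eq {x y : ℝ} (hx : Irrational x) (hy : Irrational y)
    (h : ∀ n, ⌊cfShift^[n] x⌋ = ⌊cfShift^[n] y⌋) : x = y := by
  have hd : (GenContFract.of x).partDens = (GenContFract.of y).partDens := by
    ext1 n
    rw [partDens_get?_of_irrational hx, partDens_get?_of_irrational hy, h]
  have hof : GenContFract.of x = GenContFract.of y := by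
    apply GenContFract.ext
    · simpa using h 0
    · ext1 n
      obtain ⟨p, hp, hpb⟩ :=
        GenContFract.exists_s_b_of_partDen (partDens_get?_of_irrational hx n)
      obtain ⟨q, hq, hqb⟩ :=
        GenContFract.exists_s_b_of_partDen (partDens_get?_of_irrational hy n)
      rw [hp, hq]
      congr 1
      cases p
      cases q
      have h1 := (GenContFract.of_partNum_eq_one_and_exists_int_partDen_eq hp).1
      have h2 := (GenContFract.of_partNum_eq_one_and_exists_int_partDen_eq hq).1
      have hn := h (n + 1)
      simp_all
  have h1 := GenContFract.of_convergence x
  rw [hof] at h1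
  exact tendsto_nhds_unique h1 (GenContFract.of_convergence y)

theorem CFEquivalent.completeQuotientEquiv {x y : ℝ} (h : CFEquivalent x y)
    (hx : Irrational x) (hy : Irrational y) : CompleteQuotientEquiv x y := by
  obtain ⟨l, a, -, -, h₁, h₂⟩ := h
  rw [cfEndsIn_iff hx] at h₁
  rw [cfEndsIn_iff hy] at h₂
  obtain ⟨m, h₁⟩ := h₁
  obtain ⟨n, h₂⟩ := h₂
  refine ⟨m + 1, n + 1, eq_of_floor_iterate_cfShift_eq (irrational_iterate_cfShift hx _)
    (irrational_iterate_cfShift hy _) fun k => ?_⟩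
  rw [← Function.iterate_add_apply, ← Function.iterate_add_apply,
    show k + (m + 1) = m + k + 1 by ring, show k + (n + 1) = n + k + 1 by ring, h₁, h₂]

theorem CompleteQuotientEquiv.cfEquivalent {x y : ℝ} (h : CompleteQuotientEquiv x y)
    (hx : Irrational x) (hy : Irrational y) {p q : ℕ} (hpq : p < q)
    (hper : cfShift^[p] y = cfShift^[q] y) : CFEquivalent x y := by
  obtain ⟨m, n, h⟩ := h
  obtain ⟨l, rfl⟩ := Nat.exists_eq_add_of_lt hpq
  have hshift : ∀ k, cfShift^[k + p + (l + 1)] y = cfShift^[k + p] y := by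
    intro k
    rw [Function.iterate_add_apply _ k p, hper, ← Function.iterate_add_apply]
    rw [show k + (p + l + 1) = k + p + (l + 1) by ring]
  -- The extra `p` shifts move past the preperiod of `y`; `x` inherits the period.
  refine ⟨l + 1, fun k => ⌊cfShift^[n + p + k + 1] y⌋, l.succ_pos, fun k => ?_,
    (cfEndsIn_iff hx).2 ⟨m + p, fun k => ?_⟩, (cfEndsIn_iff hy).2 ⟨n + p, fun k => rfl⟩⟩
  · have := hshift (n + k + 1)
    simp only
    rw [show n + p + (k + (l + 1)) + 1 = n + k + 1 + p + (l + 1) by ring, this,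
      show n + k + 1 + p = n + p + k + 1 by ring]
  · rw [show m + p + k + 1 = (p + k + 1) + m by ring,
      show n + p + k + 1 = (p + k + 1) + n by ring, Function.iterate_add_apply, h,
      ← Function.iterate_add_apply]

/-! ### Lagrange's theorem for `√N` -/

/-- `x = (P + √N) / Q` is a reduced quadratic irrational: `x > 1` and its conjugate lies
between `-1` and `0`. -/
def IsReducedSqrt (N : ℤ) (x : ℝ) : Prop :=
  ∃ P Q : ℤ, Q ∣ N - P ^ 2 ∧ 0 < Q ∧ (P : ℝ) < √N ∧ √N < P + Q ∧ (Q : ℝ) < P + √N ∧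
    x = (P + √N) / Q

theorem finite_setOf_isReducedSqrt {N : ℤ} (hN : 0 < N) : {x | IsReducedSqrt N x}.Finite := by
  refine ((Finset.Icc (0 : ℤ) (2 * N) ×ˢ Finset.Icc (0 : ℤ) (2 * N)).finite_toSet.image
    fun p => ((p.1 : ℝ) + √N) / p.2).subset ?_
  rintro x ⟨P, Q, -, hQ, hP, h1, h2, rfl⟩
  have hN1 : (1 : ℝ) ≤ N := by exact_mod_cast hN
  have hs : √(N : ℝ) ≤ N := Real.sqrt_le_iff.2 ⟨by linarith, by nlinarith⟩
  refine ⟨(P, Q), ?_, rfl⟩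
  have e1 : (0 : ℝ) < P := by linarith
  have e2 : (P : ℝ) ≤ 2 * N := by linarith
  have e3 : (Q : ℝ) ≤ 2 * N := by linarith
  have e1' : 0 < P := by exact_mod_cast e1
  have e2' : P ≤ 2 * N := by exact_mod_cast e2
  have e3' : Q ≤ 2 * N := by exact_mod_cast e3
  simp only [Finset.coe_product, Set.mem_prod, Finset.coe_Icc, Set.mem_Icc]
  omega

/-- The classical recursion `P' = aQ - P`, `Q' = (N - P'²)/Q`, where `a` is the floor; `Q'` is
integral because `Q ∣ N - P²`. -/
theorem IsReducedSqrt.cfShift {N : ℤ} (hN : 0 < N) (hirr : Irrational √(N : ℝ)) {x : ℝ}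
    (hx : IsReducedSqrt N x) : IsReducedSqrt N (cfShift x) := by
  obtain ⟨P, Q, ⟨R, hR⟩, hQ, hP, h1, h2, rfl⟩ := hx
  have hsq : √(N : ℝ) ^ 2 = N := Real.sq_sqrt (by exact_mod_cast hN.le)
  have hQ0 : (0 : ℝ) < Q := by exact_mod_cast hQ
  set r := √(N : ℝ) with hr
  set a := ⌊((P : ℝ) + r) / Q⌋ with ha
  have ha1 : (1 : ℝ) ≤ a := by
    have : 1 ≤ a := Int.le_floor.2 (by rw [le_div_iff₀ hQ0]; push_cast; linarith)
    exact_mod_cast this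
  have hle : a * (Q : ℝ) ≤ P + r := (le_div_iff₀ hQ0).1 (Int.floor_le _)
  have hlt : P + r < (a + 1) * (Q : ℝ) := (div_lt_iff₀ hQ0).1 (Int.lt_floor_add_one _)
  have hne : r ≠ ((a * Q - P : ℤ) : ℝ) := hirr.ne_int _
  have hP' : ((a * Q - P : ℤ) : ℝ) < r := lt_of_le_of_ne (by push_cast; linarith) hne.symm
  have hQ'R : ((R + 2 * a * P - a ^ 2 * Q : ℤ) : ℝ) * Q =
      (r - (a * Q - P : ℤ)) * (r + (a * Q - P : ℤ)) := by
    have : (N : ℝ) - P ^ 2 = Q * R := by exact_mod_cast hR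
    push_cast
    linear_combination -hsq - this
  set P' : ℤ := a * Q - P with hP'def
  set Q' : ℤ := R + 2 * a * P - a ^ 2 * Q with hQ'def
  have hP'c : (P' : ℝ) = a * Q - P := by rw [hP'def]; push_cast; ring
  have haQ : (Q : ℝ) ≤ a * Q := le_mul_of_one_le_left hQ0.le ha1
  have hd : 0 < r - P' := by linarith
  have hs : (Q : ℝ) < r + P' := by linarith
  have hQ' : (0 : ℝ) < Q' := by
    refine pos_of_mul_pos_left (b := (Q : ℝ)) ?_ hQ0.le
    rw [hQ'R]
    exact mul_pos hd (by linarith)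
  refine ⟨P', Q', ⟨Q, ?_⟩, by exact_mod_cast hQ', hP', ?_, ?_, ?_⟩
  · rw [hP'def, hQ'def]
    linear_combination hR
  · have : (r - P') * Q < Q' * Q := by
      rw [hQ'R]
      exact mul_lt_mul_of_pos_left hs hd
    linarith [lt_of_mul_lt_mul_right this hQ0.le]
  · have : Q' * (Q : ℝ) < (r + P') * Q := by
      rw [hQ'R, mul_comm]
      exact mul_lt_mul_of_pos_left (by linarith) (by linarith)
    linarith [lt_of_mul_lt_mul_right this hQ0.le]
  · have hf : Int.fract (((P : ℝ) + r) / Q) = (r - P') / Q := by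
      rw [← Int.self_sub_floor, ← ha, hP'c]
      field_simp
      ring
    rw [_root_.cfShift, hf, inv_div, div_eq_div_iff hd.ne' hQ'.ne']
    linear_combination hQ'R

theorem isReducedSqrt_cfShift_sqrt {N : ℤ} (hN : 0 < N) (hirr : Irrational √(N : ℝ)) :
    IsReducedSqrt N (cfShift √N) := by
  have hsq : √(N : ℝ) ^ 2 = N := Real.sq_sqrt (by exact_mod_cast hN.le)
  have hN1 : (1 : ℝ) ≤ N := by exact_mod_cast hN
  have hr1 : 1 ≤ √(N : ℝ) := Real.one_le_sqrt.2 hN1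
  have hfl := Int.self_sub_floor √(N : ℝ)
  have hle := Int.floor_le √(N : ℝ)
  have hlt := Int.lt_floor_add_one √(N : ℝ)
  have hne := hirr.ne_int ⌊√(N : ℝ)⌋
  have hf1 : (1 : ℝ) ≤ ⌊√(N : ℝ)⌋ := by
    have : 1 ≤ ⌊√(N : ℝ)⌋ := Int.le_floor.2 (by simpa using hr1)
    exact_mod_cast this
  rw [cfShift, ← hfl]
  set f := ⌊√(N : ℝ)⌋
  set r := √(N : ℝ)
  have hlt' : (f : ℝ) < r := lt_of_le_of_ne hle hne.symm
  have hQ : ((N - f ^ 2 : ℤ) : ℝ) = (r - f) * (r + f) := by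
    push_cast
    linear_combination -hsq
  have hd : 0 < r - f := by linarith
  have hQ0 : (0 : ℝ) < (N - f ^ 2 : ℤ) := by
    rw [hQ]
    exact mul_pos hd (by linarith)
  refine ⟨f, N - f ^ 2, dvd_rfl, by exact_mod_cast hQ0, hlt', ?_, ?_, ?_⟩
  · rw [hQ]
    nlinarith
  · rw [hQ]
    nlinarith
  · rw [eq_div_iff hQ0.ne', hQ]
    field_simp
    ring

theorem exists_iterate_cfShift_sqrt_eq {N : ℤ} (hN : 0 < N) (hirr : Irrational √(N : ℝ)) :
    ∃ p q : ℕ, p < q ∧ cfShift^[p] √(N : ℝ) = cfShift^[q] √(N : ℝ) := by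
  have hred : ∀ n : ℕ, IsReducedSqrt N (cfShift^[n + 1] √(N : ℝ)) := by
    intro n
    induction n with
    | zero => exact isReducedSqrt_cfShift_sqrt hN hirr
    | succ n ih =>
      rw [Function.iterate_succ_apply']
      exact ih.cfShift hN hirr
  obtain ⟨p, q, hpq, h⟩ := (finite_setOf_isReducedSqrt hN).exists_lt_map_eq_of_forall_mem
    (f := fun n : ℕ => cfShift^[n + 1] √(N : ℝ)) hred
  exact ⟨p + 1, q + 1, by omega, h⟩

theorem cfEquivalent_sqrt_iff_intMoebiusEquiv {N : ℤ} (hN : 0 < N)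
    (hirr : Irrational √(N : ℝ)) {x : ℝ} (hx : Irrational x) :
    CFEquivalent x √(N : ℝ) ↔ IntMoebiusEquiv x √(N : ℝ) := by
  obtain ⟨p, q, hpq, h⟩ := exists_iterate_cfShift_sqrt_eq hN hirr
  exact ⟨fun e => (e.completeQuotientEquiv hx hirr).intMoebiusEquiv hx hirr,
    fun e => (e.completeQuotientEquiv hx).cfEquivalent hx hirr hpq h⟩

/-! ### Arithmetic of the equation, the ideals and the Möbius maps -/

theorem irrational_sqrt_of_modEq {N : ℤ} (hpos : 0 < N) (hN : N ≡ 5 [ZMOD 8]) :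
    Irrational √(N : ℝ) := by
  rw [irrational_sqrt_intCast_iff]
  refine ⟨?_, hpos.le⟩
  rintro ⟨k, rfl⟩
  have h : k * k % 8 = 5 := hN
  rw [Int.mul_emod] at h
  have h0 := Int.emod_nonneg k (by norm_num : (8 : ℤ) ≠ 0)
  have h1 := Int.emod_lt_of_pos k (by norm_num : (0 : ℤ) < 8)
  interval_cases k % 8 <;> omega

/-- The equation `x² - N y² = ±4` is solvable in odd integers. -/
def OddPellFour (N : ℤ) : Prop :=
  ∃ x y : ℤ, Odd x ∧ Odd y ∧ (x ^ 2 - N * y ^ 2 = 4 ∨ x ^ 2 - N * y ^ 2 = -4)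

/-- Odd `x`, `y` agree modulo `4` up to sign, and the sign of `y` is free. -/
theorem OddPellFour.exists_dvd_sub {N : ℤ} (h : OddPellFour N) {s : ℤ} (hs : s = 1 ∨ s = -1) :
    ∃ x y : ℤ, Odd y ∧ 4 ∣ x - s * y ∧ (x ^ 2 - N * y ^ 2 = 4 ∨ x ^ 2 - N * y ^ 2 = -4) := by
  obtain ⟨x, y, hx, hy, h⟩ := h
  obtain ⟨k, rfl⟩ := hx
  obtain ⟨l, rfl⟩ := hy
  have : 4 ∣ 2 * k + 1 - s * (2 * l + 1) ∨ 4 ∣ 2 * k + 1 - s * -(2 * l + 1) := by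
    rcases hs with rfl | rfl <;> omega
  rcases this with hd | hd
  · exact ⟨_, _, ⟨l, rfl⟩, hd, h⟩
  · exact ⟨_, _, (odd_two_mul_add_one l).neg, hd, by rwa [neg_sq]⟩

theorem odd_or_both_even_of_norm {N : ℤ} (hN : N ≡ 5 [ZMOD 8]) {x y : ℤ}
    (h : x ^ 2 - N * y ^ 2 = 4 ∨ x ^ 2 - N * y ^ 2 = -4) :
    (Odd x ∧ Odd y) ∨ (Even x ∧ Even y) := by
  have hNo : Odd N := by
    rw [Int.odd_iff]
    have : N % 8 = 5 := hN
    omega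
  have he : Even (x ^ 2 - N * y ^ 2) := by rcases h with h | h <;> rw [h] <;> decide
  have := hNo
  rw [← Int.not_even_iff_odd] at this
  simp only [Int.even_sub, Int.even_pow, Int.even_mul, this, false_or, ne_eq,
    OfNat.ofNat_ne_zero, not_false_eq_true, and_true] at he
  rw [← Int.not_even_iff_odd, ← Int.not_even_iff_odd]
  tauto

theorem oddPellFour_iff_exists_norm {N : ℤ} (hN : N ≡ 5 [ZMOD 8]) :
    OddPellFour N ↔ ∃ α : Zsqrtd N, (α.norm = 4 ∨ α.norm = -4) ∧
      ¬ (∃ n : ℤ, Associated α (n : Zsqrtd N)) := by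
  constructor
  · rintro ⟨x, y, hx, hy, h⟩
    refine ⟨⟨x, y⟩, by simpa [Zsqrtd.norm_def, sq, mul_assoc] using h, ?_⟩
    rintro ⟨n, hn⟩
    obtain ⟨u, hu⟩ := hn.symm
    have hre := congrArg Zsqrtd.re hu
    have him := congrArg Zsqrtd.im hu
    simp at hre him
    have hu1 : (u : Zsqrtd N).norm = 1 ∨ (u : Zsqrtd N).norm = -1 := by
      have := (Zsqrtd.norm_eq_one_iff).2 u.isUnit
      omega
    have hn2 : n * n = 4 ∨ n * n = -4 := by
      rw [Zsqrtd.norm_def] at hu1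
      rw [← hre, ← him] at h
      have e : (n * (u : Zsqrtd N).re) ^ 2 - N * (n * (u : Zsqrtd N).im) ^ 2 =
        n * n * ((u : Zsqrtd N).re * (u : Zsqrtd N).re -
          N * (u : Zsqrtd N).im * (u : Zsqrtd N).im) := by ring
      rw [e] at h
      rcases hu1 with hu1 | hu1 <;> rw [hu1] at h <;> omega
    have hno : Odd n := by
      rw [← hre] at hx
      exact (Int.odd_mul.1 hx).1
    have : Odd (n * n) := hno.mul hno
    rcases hn2 with h | h <;> rw [h] at this <;> revert this <;> decide
  · rintro ⟨α, h, hα⟩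
    have h' : α.re ^ 2 - N * α.im ^ 2 = 4 ∨ α.re ^ 2 - N * α.im ^ 2 = -4 := by
      simpa [Zsqrtd.norm_def, sq, mul_assoc] using h
    rcases odd_or_both_even_of_norm hN h' with ⟨hx, hy⟩ | ⟨hx, hy⟩
    · exact ⟨_, _, hx, hy, h'⟩
    · exfalso
      obtain ⟨k, hk⟩ := hx
      obtain ⟨l, hl⟩ := hy
      have hu : IsUnit (⟨k, l⟩ : Zsqrtd N) := by
        rw [← Zsqrtd.norm_eq_one_iff]
        have : (⟨k, l⟩ : Zsqrtd N).norm = 1 ∨ (⟨k, l⟩ : Zsqrtd N).norm = -1 := by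
          rw [Zsqrtd.norm_def]
          rw [hk, hl] at h'
          have e : (k + k) ^ 2 - N * (l + l) ^ 2 = 4 * (k * k - N * l * l) := by ring
          rw [e] at h'
          simp only
          omega
        omega
      refine hα ⟨2, Associated.symm ⟨hu.unit, ?_⟩⟩
      ext <;> simp [hk, hl, two_mul]

theorem oddPellFour_iff_isPrincipal {N : ℤ} (hN : N ≡ 5 [ZMOD 8]) {s : ℤ}
    (hs : s = 1 ∨ s = -1) : OddPellFour N ↔ (idealI N s).IsPrincipal := by
  have hss : s * s = 1 := by rcases hs with rfl | rfl <;> norm_num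
  have hN8 : N % 8 = 5 := hN
  have hN4 : N ≡ 1 [ZMOD 4] := by
    change N % 4 = 1
    omega
  constructor
  · intro h
    obtain ⟨x, y, -, ⟨t, ht⟩, hn⟩ := h.exists_dvd_sub hs
    obtain ⟨k, hk⟩ : 4 ∣ N - 1 := by omega
    have hx : x = s * y + 4 * t := by linarith
    have hN1 : N = 1 + 4 * k := by linarith
    obtain ⟨e, he, hee⟩ : ∃ e : ℤ, x ^ 2 - N * y ^ 2 = 4 * e ∧ e * e = 1 := by
      rcases hn with h | h
      · exact ⟨1, by linarith, by norm_num⟩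
      · exact ⟨-1, by linarith, by norm_num⟩
    refine ⟨⟨⟨x, y⟩, ?_⟩⟩
    rw [Ideal.submodule_span_eq]
    apply le_antisymm
    · rw [idealI, Ideal.span_le]
      rintro z (rfl | rfl)
      -- The cofactor is `e` times the conjugate of `x + y√N`, whose norm is `4e`.
      · refine Ideal.mem_span_singleton.2 ⟨⟨e * x, -e * y⟩, ?_⟩
        ext
        · simp [Zsqrtd.re_ofNat]
          linear_combination -e * he - 4 * hee
        · simp [Zsqrtd.im_ofNat]
          ring
      -- The cofactor is `e(√N + s)(x - y√N)/4`, integral since `4 ∣ x - s * y`.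
      · refine Ideal.mem_span_singleton.2 ⟨⟨e * (s * t - k * y), e * t⟩, ?_⟩
        have he4 : (s * y + 4 * t) ^ 2 - (1 + 4 * k) * y ^ 2 = 4 * e := by
          rw [← hx, ← hN1]; exact he
        have he1 : 2 * s * y * t + 4 * t ^ 2 - k * y ^ 2 = e := by
          have : 4 * (2 * s * y * t + 4 * t ^ 2 - k * y ^ 2) = 4 * e := by
            linear_combination he4 - y ^ 2 * hss
          linarith
        ext
        · simp
          rw [hx, hN1]
          linear_combination (-s * e) * he1 - s * hee + (e * y * t) * hss
        · simp
          rw [hx]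
          linear_combination (-e) * he1 - hee
    · rw [Ideal.span_singleton_le_iff_mem, mem_idealI_iff_lattice N s hN4 hs]
      refine ⟨t, y, ?_⟩
      ext
      · simp [Zsqrtd.re_ofNat, Zsqrtd.im_ofNat]
        linarith
      · simp [Zsqrtd.re_ofNat, Zsqrtd.im_ofNat]
  · rintro ⟨⟨α, hα⟩⟩
    rw [Ideal.submodule_span_eq] at hα
    have hαI : α ∈ idealI N s := hα ▸ Ideal.mem_span_singleton_self α
    obtain ⟨β, hβ⟩ : α ∣ 4 := Ideal.mem_span_singleton.1 <| by
      rw [← hα]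
      exact Ideal.subset_span (by simp)
    obtain ⟨γ, hγ⟩ : α ∣ Zsqrtd.sqrtd + (s : Zsqrtd N) := Ideal.mem_span_singleton.1 <| by
      rw [← hα]
      exact Ideal.subset_span (by simp)
    obtain ⟨u, v, huv⟩ := (mem_idealI_iff_lattice N s hN4 hs α).1 hαI
    have h16 : α.norm ∣ 16 := by
      have := congrArg Zsqrtd.norm hβ
      rw [Zsqrtd.norm_mul] at this
      refine ⟨β.norm, ?_⟩
      rw [← this, Zsqrtd.norm_def]
      simp [Zsqrtd.re_ofNat, Zsqrtd.im_ofNat]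
    have hN1 : α.norm ∣ 1 - N := by
      have := congrArg Zsqrtd.norm hγ
      rw [Zsqrtd.norm_mul] at this
      refine ⟨γ.norm, ?_⟩
      rw [← this, Zsqrtd.norm_def]
      simp [hss]
    have h4 : 4 ∣ α.norm := by
      obtain ⟨k, hk⟩ : 4 ∣ N - 1 := by omega
      refine ⟨4 * u ^ 2 + 2 * u * s * v - k * v ^ 2, ?_⟩
      rw [huv, Zsqrtd.norm_def]
      simp [Zsqrtd.re_ofNat, Zsqrtd.im_ofNat]
      linear_combination v ^ 2 * hss - v ^ 2 * hk
    have hnorm : α.norm = 4 ∨ α.norm = -4 := by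
      have hd : α.norm ∣ 4 := by
        obtain ⟨j, hj⟩ : 8 ∣ 5 - N := by omega
        -- Bézout identity for `gcd(16, 1 - N) = 4`: `N ≡ 5 mod 8` makes `1 - N` four times an odd
        -- number.
        have h9 : (4 : ℤ) = 16 * (-j ^ 2 + j) + (1 - N) * (2 * j - 1) := by
          rw [show 1 - N = 8 * j - 4 by linarith]
          ring
        rw [h9]
        exact dvd_add (dvd_mul_of_dvd_left h16 _) (dvd_mul_of_dvd_left hN1 _)
      have := Int.natAbs_eq_of_dvd_dvd hd h4
      omega
    have h' : α.re ^ 2 - N * α.im ^ 2 = 4 ∨ α.re ^ 2 - N * α.im ^ 2 = -4 := by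
      simpa [Zsqrtd.norm_def, sq, mul_assoc] using hnorm
    rcases odd_or_both_even_of_norm hN h' with ⟨hx, hy⟩ | ⟨hx, hy⟩
    · exact ⟨_, _, hx, hy, h'⟩
    · exfalso
      -- If `2 ∣ α`, then `2 ∣ √N + s`, whose `√N`-coefficient is `1`.
      have him := congrArg Zsqrtd.im hγ
      simp at him
      have : Even (1 : ℤ) := by
        rw [him]
        exact (hx.mul_right _).add (hy.mul_right _)
      revert this
      decide

theorem oddPellFour_iff_intMoebiusEquiv {N : ℤ} (hpos : 0 < N) (hN : N ≡ 5 [ZMOD 8]) {s : ℤ}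
    (hs : s = 1 ∨ s = -1) :
    OddPellFour N ↔ IntMoebiusEquiv ((√(N : ℝ) + s) / 4) √(N : ℝ) := by
  have hirr := irrational_sqrt_of_modEq hpos hN
  have hss : s * s = 1 := by rcases hs with rfl | rfl <;> norm_num
  have hN8 : N % 8 = 5 := hN
  have hsq : √(N : ℝ) ^ 2 = N := Real.sq_sqrt (by exact_mod_cast hpos.le)
  constructor
  · intro h
    obtain ⟨x, y, -, ⟨t, ht⟩, hn⟩ := h.exists_dvd_sub hs
    obtain ⟨k, hk⟩ : 4 ∣ N - 1 := by omega
    have hx : x = s * y + 4 * t := by linarith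
    have hN1 : N = 1 + 4 * k := by linarith
    -- Setting `a = x`, `c = y`, the entries `b` and `d` are forced by the two linear relations
    -- `hz`, `hz'` of the converse.
    refine ⟨x, k * y - s * t, y, t, ?_, ?_⟩
    · have : 4 * (x * t - (k * y - s * t) * y) = x ^ 2 - N * y ^ 2 := by
        rw [hx, hN1]
        linear_combination -y ^ 2 * hss
      omega
    · have hx' : (x : ℝ) = s * y + 4 * t := by exact_mod_cast hx
      have hN1' : (N : ℝ) = 1 + 4 * k := by exact_mod_cast hN1
      have hss' : (s : ℝ) * s = 1 := by exact_mod_cast hss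
      push_cast
      rw [hx']
      linear_combination (y / 4 : ℝ) * hsq + (y / 4 : ℝ) * hN1' - (y / 4 : ℝ) * hss'
  · rintro ⟨a, b, c, d, hdet, h⟩
    have key : ((a - c * s - 4 * d : ℤ) : ℝ) * √(N : ℝ) = ((c * N - a * s - 4 * b : ℤ) : ℝ) := by
      push_cast
      linear_combination -4 * h + (c : ℝ) * hsq
    have hz : a - c * s - 4 * d = 0 := by
      by_contra hne
      exact (hirr.intCast_mul hne).ne_int _ key
    have hz' : c * N - a * s - 4 * b = 0 := by
      rw [hz] at key
      have : ((c * N - a * s - 4 * b : ℤ) : ℝ) = 0 := by rw [← key]; simp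
      exact_mod_cast this
    have hn : a ^ 2 - N * c ^ 2 = 4 * (a * d - b * c) := by
      linear_combination a * hz - c * hz'
    have h4 : a ^ 2 - N * c ^ 2 = 4 ∨ a ^ 2 - N * c ^ 2 = -4 := by omega
    rcases odd_or_both_even_of_norm hN h4 with ⟨ha, hc⟩ | ⟨ha, hc⟩
    · exact ⟨a, c, ha, hc, h4⟩
    · exfalso
      have : Even (a * d - b * c) := (ha.mul_right _).sub (hc.mul_left _)
      rcases hdet with e | e <;> rw [e] at this <;> revert this <;> decide

theorem oddPellFour_iff_cfEquivalent {N : ℤ} (hpos : 0 < N) (hN : N ≡ 5 [ZMOD 8]) {s : ℤ}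
    (hs : s = 1 ∨ s = -1) :
    OddPellFour N ↔ CFEquivalent ((√(N : ℝ) + s) / 4) √(N : ℝ) := by
  have hirr := irrational_sqrt_of_modEq hpos hN
  have hirr' : Irrational ((√(N : ℝ) + s) / 4) := by
    exact_mod_cast (hirr.add_intCast s).div_natCast (m := 4) (by norm_num)
  rw [oddPellFour_iff_intMoebiusEquiv hpos hN hs,
    cfEquivalent_sqrt_iff_intMoebiusEquiv hpos hirr hirr']

theorem mainTheorem4 (N : ℤ) (hpos : 0 < N) (hN : N ≡ 5 [ZMOD 8]) :
    List.TFAE [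
      ∃ x y : ℤ, Odd x ∧ Odd y ∧ (x ^ 2 - N * y ^ 2 = 4 ∨ x ^ 2 - N * y ^ 2 = -4),
      ∃ α : Zsqrtd N, (α.norm = 4 ∨ α.norm = -4) ∧
        ¬ (∃ n : ℤ, Associated α (n : Zsqrtd N)),
      (idealI N 1).IsPrincipal,
      (idealI N (-1)).IsPrincipal,
      CFEquivalent ((Real.sqrt N + 1) / 4) (Real.sqrt N),
      CFEquivalent ((Real.sqrt N - 1) / 4) (Real.sqrt N)] := by
  have h5 : OddPellFour N ↔ CFEquivalent ((Real.sqrt N + 1) / 4) (Real.sqrt N) := by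
    simpa using oddPellFour_iff_cfEquivalent hpos hN (Or.inl rfl)
  have h6 : OddPellFour N ↔ CFEquivalent ((Real.sqrt N - 1) / 4) (Real.sqrt N) := by
    simpa [← sub_eq_add_neg] using oddPellFour_iff_cfEquivalent hpos hN (Or.inr rfl)
  tfae_have 1 ↔ 2 := oddPellFour_iff_exists_norm hN
  tfae_have 1 ↔ 3 := oddPellFour_iff_isPrincipal hN (Or.inl rfl)
  tfae_have 1 ↔ 4 := oddPellFour_iff_isPrincipal hN (Or.inr rfl)
  tfae_have 1 ↔ 5 := h5
  tfae_have 1 ↔ 6 := h6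
  tfae_finish
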